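/- Let $p>2$ be a prime. A growth function is an increasing function $\mathbb{R}^+\to\mathbb{R}^+$, and $\rho\ge\rho_0$ means $\rho(x)\ge\rho_0(x)$ for all $x\in\mathbb{R}^+$. A quadratic factor $\mathcal{B}=(\mathcal{L},\mathcal{Q})$ on $\mathbb{F}_p^n$ of complexity $(\ell,q)$ consists of linearly independent vectors $r_1,\dots,r_\ell\in\mathbb{F}_p^n$ and symmetric $n\times n$ matrices $M_1,\dots,M_q$ over $\mathbb{F}_p$; its rank is the minimum of $\mathrm{rk}(\lambda_1M_1+\dots+\lambda_qM_q)$ over all $(\lambda_1,\dots,\lambda_q)\in\mathbb{F}_p^q\setminus\{0\}$ (and $\infty$ if $q=0$). For $a=(u,v)\in\mathbb{F}_p^\ell\times\mathbb{F}_p^q=\mathbb{F}_p^{\ell+q}$ and $b\in\mathbb{F}_p^q$ let $$B(a)=\{x\in\mathbb{F}_p^n: x^Tr_i=u_i\ (1\le i\le\ell),\ x^TM_jx=v_j\ (1\le j\le q)\},$$ $$\beta(b)=\{(x,y)\in\mathbb{F}_p^n\times\mathbb{F}_p^n: x^TM_jy=b_j\ (1\le j\le q)\},\qquad \mu_{\beta(b)}=\frac{p^{2n}}{|\beta(b)|}1_{\beta(b)}.$$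 For $d=(a_1,a_2,a_3,b_{12},b_{13},b_{23})\in(\mathbb{F}_p^{\ell+q})^3\times(\mathbb{F}_p^q)^3$ let $\Sigma(d)=a_1+a_2+a_3+2(0,b_{12})+2(0,b_{13})+2(0,b_{23})\in\mathbb{F}_p^{\ell+q}$, and for $f:\mathbb{F}_p^n\to\mathbb{C}$ define the local semi-norm $\|f\|_{U^3(d)}\ge 0$ by $$\|f\|_{U^3(d)}^8=\mathbb{E}_{x_0,x_1\in B(a_1)}\mathbb{E}_{y_0,y_1\in B(a_2)}\mathbb{E}_{z_0,z_1\in B(a_3)}\prod_{i,j\in\{0,1\}}\mu_{\beta(b_{12})}(x_i,y_j)\prod_{i,k\in\{0,1\}}\mu_{\beta(b_{13})}(x_i,z_k)\prod_{j,k\in\{0,1\}}\mu_{\beta(b_{23})}(y_j,z_k)\prod_{\omega\in\{0,1\}^3}\mathcal{C}^{|\omega|}f(x_{\omega(1)}+y_{\omega(2)}+z_{\omega(3)}),$$ where $\mathbb{E}$ denotes the average over the indicated set, $\mathcal{C}$ is complex conjugation and $|\omega|$ is the number of ones in $\omega$. **Proposition (Locally sparse implies locally uniform).** For every $\varepsilon>0$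 there exists a growth function $\rho_0=\rho_0(\varepsilon)$ such that for any growth function $\rho\ge\rho_0$ the following holds. Let $\mathcal{B}=(\mathcal{L},\mathcal{Q})$ be a quadratic factor on $\mathbb{F}_p^n$ of complexity $(\ell,q)$ and rank at least $\rho(\ell+q)$, let $d=(a_1,a_2,a_3,b_{12},b_{13},b_{23})\in(\mathbb{F}_p^{\ell+q})^3\times(\mathbb{F}_p^q)^3$, let $A\subseteq\mathbb{F}_p^n$, and let $\alpha=|A\cap B(\Sigma(d))|/|B(\Sigma(d))|$ be the density of $A$ on the atom $B(\Sigma(d))$. If $\alpha\le\varepsilon$, then $$\|1_A-\alpha\|_{U^3(d)}\le 2\varepsilon^{1/8}.$$ -/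

import Mathlib

open scoped BigOperators ENNReal

namespace QuadFourier

/-- Growth functions: increasing functions `ℝ⁺ → ℝ⁺`. Only the values on positive reals matter. -/
def IsGrowthFunction (σ : ℝ → ℝ) : Prop :=
  (∀ x, 0 < x → 0 < σ x) ∧ MonotoneOn σ (Set.Ioi 0)

/-- A quadratic factor on `𝔽_p^n` of complexity `(ℓ, q)`: linearly independent vectors
`r_1, …, r_ℓ` together with symmetric `n × n` matrices `M_1, …, M_q`. -/
structure QuadraticFactor (p n ℓ q : ℕ) where
  r : Fin ℓ → Fin n → ZMod p
  M : Fin q → Matrix (Fin n) (Fin n) (ZMod p)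
  linearIndependent : LinearIndependent (ZMod p) r
  isSymm : ∀ j, (M j).IsSymm

/-- Labels of atoms, `𝔽_p^{ℓ+q} = 𝔽_p^ℓ × 𝔽_p^q`. -/
abbrev AtomLabel (p ℓ q : ℕ) : Type := (Fin ℓ → ZMod p) × (Fin q → ZMod p)

/-- Tuples `d = (a₁, a₂, a₃, b₁₂, b₁₃, b₂₃)`. -/
structure TripleLabel (p ℓ q : ℕ) where
  a₁ : AtomLabel p ℓ q
  a₂ : AtomLabel p ℓ q
  a₃ : AtomLabel p ℓ q
  b₁₂ : Fin q → ZMod p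
  b₁₃ : Fin q → ZMod p
  b₂₃ : Fin q → ZMod p

/-- `Σ(d) = a₁ + a₂ + a₃ + 2 (0 b₁₂) + 2 (0 b₁₃) + 2 (0 b₂₃)`. -/
def TripleLabel.sigma {p ℓ q : ℕ} (d : TripleLabel p ℓ q) : AtomLabel p ℓ q :=
  d.a₁ + d.a₂ + d.a₃ + (0, 2 • d.b₁₂) + (0, 2 • d.b₁₃) + (0, 2 • d.b₂₃)

/-- The normalised indicator (characteristic measure) `μ_β = 1_β · |V|² / |β|` of a set of
pairs `β ⊆ V × V`. -/
noncomputable def charMeasure {V : Type*} [Fintype V] [DecidableEq V]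
    (β : Finset (V × V)) (x y : V) : ℝ :=
  if (x, y) ∈ β then (Fintype.card V : ℝ) ^ 2 / (β.card : ℝ) else 0

/-- The density `|A ∩ B| / |B|` of `A` on `B`. -/
noncomputable def density {V : Type*} [DecidableEq V] (A B : Finset V) : ℝ :=
  ((A ∩ B).card : ℝ) / (B.card : ℝ)

namespace QuadraticFactor

variable {p n ℓ q : ℕ}

/-- The rank of a factor: the minimum of `rk (c₁ M₁ + ⋯ + c_q M_q)` over all nonzero `c ∈ 𝔽_p^q`.
If `q = 0` the minimum is over the empty set and equals `⊤`. -/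
noncomputable def rank (𝓑 : QuadraticFactor p n ℓ q) : ℕ∞ :=
  ⨅ (c : Fin q → ZMod p) (_ : c ≠ 0), ((∑ j, c j • 𝓑.M j).rank : ℕ∞)

variable [Fact p.Prime]

/-- The atom `B(a)`, for `a = (u, v)`: all `x` with `xᵀ r_i = u_i` and `xᵀ M_j x = v_j`. -/
def atom (𝓑 : QuadraticFactor p n ℓ q) (a : AtomLabel p ℓ q) : Finset (Fin n → ZMod p) :=
  {x | (∀ i, x ⬝ᵥ 𝓑.r i = a.1 i) ∧ ∀ j, x ⬝ᵥ (𝓑.M j).mulVec x = a.2 j}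

/-- The bilinear level set `β(b)`: all pairs `(x, y)` with `xᵀ M_j y = b_j` for every `j`. -/
def bilinearLevelSet (𝓑 : QuadraticFactor p n ℓ q) (b : Fin q → ZMod p) :
    Finset ((Fin n → ZMod p) × (Fin n → ZMod p)) :=
  {w | ∀ j, w.1 ⬝ᵥ (𝓑.M j).mulVec w.2 = b j}

/-- The local `U³(d)` inner product of a family `(f_ω)`, `ω ∈ {0,1}³`. The pairs `(x₀, x₁)`,
`(y₀, y₁)`, `(z₀, z₁)` are written as functions on `Fin 2`, and `|ω| = ω₀ + ω₁ + ω₂` is the number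
of ones in `ω`; complex conjugation is applied `|ω|` times. -/
noncomputable def localU3Inner (𝓑 : QuadraticFactor p n ℓ q) (d : TripleLabel p ℓ q)
    (f : (Fin 3 → Fin 2) → (Fin n → ZMod p) → ℂ) : ℂ :=
  𝔼 x ∈ Fintype.piFinset (fun _ : Fin 2 => 𝓑.atom d.a₁),
  𝔼 y ∈ Fintype.piFinset (fun _ : Fin 2 => 𝓑.atom d.a₂),
  𝔼 z ∈ Fintype.piFinset (fun _ : Fin 2 => 𝓑.atom d.a₃),
    (∏ i, ∏ j, (charMeasure (𝓑.bilinearLevelSet d.b₁₂) (x i) (y j) : ℂ)) *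
    (∏ i, ∏ k, (charMeasure (𝓑.bilinearLevelSet d.b₁₃) (x i) (z k) : ℂ)) *
    (∏ j, ∏ k, (charMeasure (𝓑.bilinearLevelSet d.b₂₃) (y j) (z k) : ℂ)) *
    ∏ ω : Fin 3 → Fin 2,
      (starRingEnd ℂ)^[∑ i, (ω i : ℕ)] (f ω (x (ω 0) + y (ω 1) + z (ω 2)))

/-- The local `U³(d)` semi-norm `⟨f, …, f⟩^{1/8}`. The inner product of eight copies of the same
function is a nonnegative real number, so it coincides with its modulus. -/
noncomputable def localU3Norm (𝓑 : QuadraticFactor p n ℓ q) (d : TripleLabel p ℓ q)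
    (f : (Fin n → ZMod p) → ℂ) : ℝ :=
  ‖𝓑.localU3Inner d (fun _ => f)‖ ^ (1 / 8 : ℝ)

end QuadraticFactor

end QuadFourier

/-!
Write `f = 1_A - α`. Bounding all but one of the eight factors of the local `U³(d)` inner product
by `1`, one is left with the average of `|f (x₀ + y₀ + z₀)|` over the configurations `(x, y, z)`,
weighted by the constant value of the characteristic measures there. Every configuration has
`x₀ + y₀ + z₀ ∈ B(Σ(d))`, so it suffices that the fibre over almost every `w ∈ B(Σ(d))` has at most
about the expected number of points: the average is then essentially that of `|f|` over `B(Σ(d))`,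
which is at most `2α`.

With `z₀` eliminated, the fibre over `w` is cut out by quadratic equations in the products of two
of the five vectors `x₀, y₀, x₁, y₁, z₁` and by linear equations with coefficient vectors `r_i` and
`M_j w`. Counting its points with additive characters, a frequency which involves a quadratic
equation contributes a quadratic Gauss sum of high rank, hence little, and a nonzero frequency which
involves only linear equations contributes nothing, as soon as the `r_i` and the `M_j w` are
linearly independent. The points `w` where they are not lie in the preimages of the span of the
`r_i` under the nonzero combinations of the `M_j`, and high rank makes these sparse.
-/

namespace QuadFourier

open scoped Finset Matrix

section ExponentialSums

open Module (finrank)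

variable {F : Type*} [Field F] {ψ : AddChar F ℂ}

section Linear

variable {V : Type*} [AddCommGroup V] [Module F V] [Fintype V]

theorem sum_addChar_linearMap (hψ : ψ ≠ 0) (L : V →ₗ[F] F) [Decidable (L = 0)] :
    ∑ v, ψ (L v) = if L = 0 then (Fintype.card V : ℂ) else 0 := by
  split_ifs with hL
  · simp [hL]
  obtain ⟨a, ha⟩ := AddChar.ne_zero_iff.1 hψ
  obtain ⟨v, rfl⟩ := LinearMap.surjective hL a
  exact AddChar.sum_eq_zero_iff_ne_zero (ψ := ψ.compAddMonoidHom L.toAddMonoidHom).2 <|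
    AddChar.ne_zero_iff.2 ⟨v, ha⟩

variable [Fintype F]

theorem sum_addChar_dotProduct [DecidableEq F] {K : Type*} [Fintype K] [DecidableEq K]
    (hψ : ψ ≠ 0) (a : K → F) :
    ∑ c : K → F, ψ (c ⬝ᵥ a) = if a = 0 then (Fintype.card F : ℂ) ^ Fintype.card K else 0 := by
  classical
  have hzero : (dotProductBilin F F).flip a = 0 ↔ a = 0 :=
    ⟨fun h => dotProduct_eq_zero a fun c => by simpa [dotProduct_comm] using DFunLike.congr_fun h c,
      fun h => by simp [h]⟩
  simpa [hzero] using sum_addChar_linearMap hψ ((dotProductBilin F F).flip a)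

theorem card_fiber_mul_pow_le {X : Type*} [AddCommGroup X] [Module F X] [DecidableEq X]
    (T : V →ₗ[F] X) (x : X) {r : ℕ} (hr : r ≤ finrank F (LinearMap.range T)) :
    #{v | T v = x} * Fintype.card F ^ r ≤ Fintype.card V := by
  by_cases hx : x ∈ Set.range T
  · have hfiber : #{v | T v = x} = Fintype.card F ^ finrank F (LinearMap.ker T) := by
      rw [AddMonoidHom.card_fiber_eq_of_mem_range T hx ⟨0, map_zero T⟩,
        ← Nat.card_eq_fintype_card, ← Module.natCard_eq_pow_finrank (V := LinearMap.ker T)]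
      simp only [← Fintype.card_subtype, ← Nat.card_eq_fintype_card]
      rfl
    rw [hfiber, ← pow_add, Module.card_eq_pow_finrank (K := F) (V := V),
      ← T.finrank_range_add_finrank_ker]
    exact Nat.pow_le_pow_right Fintype.card_pos (by omega)
  · rw [Finset.filter_eq_empty_iff.2 fun v _ hv => hx ⟨v, hv⟩]
    simp

end Linear

section Equidistribution

variable [Fintype F] [DecidableEq F] {S K : Type*} [Fintype S] [Fintype K]

theorem card_pow_mul_card_fiber_eq_sum_addChar [DecidableEq K] (hψ : ψ ≠ 0)
    (Φ : S → K → F) (u : K → F) :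
    (Fintype.card F : ℂ) ^ Fintype.card K * #{v | Φ v = u} =
      ∑ c : K → F, ψ (-(c ⬝ᵥ u)) * ∑ v, ψ (c ⬝ᵥ Φ v) := by
  classical
  calc (Fintype.card F : ℂ) ^ Fintype.card K * #{v | Φ v = u}
      = ∑ v, ∑ c : K → F, ψ (c ⬝ᵥ (Φ v - u)) := by
        simp only [sum_addChar_dotProduct hψ, sub_eq_zero]
        simp [Finset.sum_ite, mul_comm]
    _ = ∑ c : K → F, ψ (-(c ⬝ᵥ u)) * ∑ v, ψ (c ⬝ᵥ Φ v) := by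
        rw [Finset.sum_comm]
        simp only [Finset.mul_sum, ← AddChar.map_add_eq_mul, dotProduct_sub, neg_add_eq_sub]

/-- Only the frequency `c = 0` contributes a main term to the Fourier expansion of the count. -/
theorem abs_card_fiber_sub_le_of_norm_sum_addChar_le (hψ : ψ ≠ 0) (Φ : S → K → F) {δ : ℝ}
    (hδ : 0 ≤ δ) (hΦ : ∀ c : K → F, c ≠ 0 → ‖∑ v, ψ (c ⬝ᵥ Φ v)‖ ≤ δ) (u : K → F) :
    |(#{v | Φ v = u} : ℝ) - Fintype.card S / Fintype.card F ^ Fintype.card K| ≤ δ := by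
  classical
  set N : ℝ := Fintype.card F ^ Fintype.card K with hN
  have hN0 : 0 < N := pow_pos (Nat.cast_pos.2 Fintype.card_pos) _
  have herror : ((N * #{v | Φ v = u} - Fintype.card S : ℝ) : ℂ) =
      ∑ c ∈ Finset.univ.erase (0 : K → F), ψ (-(c ⬝ᵥ u)) * ∑ v, ψ (c ⬝ᵥ Φ v) := by
    have hcount := card_pow_mul_card_fiber_eq_sum_addChar hψ Φ u
    rw [← Finset.add_sum_erase _ _ (Finset.mem_univ (0 : K → F))] at hcount
    push_cast [hN]
    rw [hcount]
    simp
  have hbound : |N * #{v | Φ v = u} - Fintype.card S| ≤ N * δ := by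
    rw [← Real.norm_eq_abs, ← Complex.norm_real, herror]
    refine (norm_sum_le_of_le _ fun c hc => ?_).trans
      (?_ : ∑ _ ∈ Finset.univ.erase (0 : K → F), δ ≤ N * δ)
    · simpa using hΦ c (Finset.ne_of_mem_erase hc)
    · rw [Finset.sum_const, nsmul_eq_mul]
      gcongr
      simpa [hN] using Nat.cast_le (α := ℝ).2
        (Finset.card_le_card (Finset.erase_subset (0 : K → F) Finset.univ))
  rwa [sub_div' hN0.ne', abs_div, abs_of_pos hN0, div_le_iff₀ hN0, mul_comm δ, mul_comm _ N]

end Equidistribution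

section Quadratic

variable {V : Type*} [AddCommGroup V] [Module F V] [Fintype V]

/-- Weyl differencing: `Q (v + h) - Q v` is affine in `v`, with linear part `polar Q h`. -/
theorem norm_sum_addChar_quadraticForm_sq_le [Finite F] [DecidableEq (V →ₗ[F] F)]
    (hψ : ψ ≠ 0) (Q : QuadraticForm F V) (L : V →ₗ[F] F) :
    ‖∑ v, ψ (Q v + L v)‖ ^ 2 ≤ #{h | Q.polarBilin h = 0} * Fintype.card V := by
  have hdiff : ∀ v h, ψ (Q (v + h) + L (v + h)) * starRingEnd ℂ (ψ (Q v + L v)) =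
      ψ (Q h + L h) * ψ (Q.polarBilin h v) := fun v h => by
    rw [← AddChar.map_neg_eq_conj, ← AddChar.map_add_eq_mul, ← AddChar.map_add_eq_mul,
      QuadraticMap.polarBilin_apply_apply, QuadraticMap.polar, add_comm h v, map_add L]
    exact congrArg ψ (by ring)
  have hsq : (∑ v, ψ (Q v + L v)) * starRingEnd ℂ (∑ v, ψ (Q v + L v)) =
      ∑ h, ψ (Q h + L h) * ∑ v, ψ (Q.polarBilin h v) := by
    simp only [map_sum, Finset.mul_sum, ← hdiff]
    rw [Finset.sum_comm (s := Finset.univ (α := V))]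
    refine Finset.sum_congr rfl fun v _ => ?_
    rw [← Finset.sum_mul, ← Equiv.sum_comp (Equiv.addLeft v)]
    simp [Finset.sum_mul]
  calc ‖∑ v, ψ (Q v + L v)‖ ^ 2
      = ‖∑ h, ψ (Q h + L h) * ∑ v, ψ (Q.polarBilin h v)‖ := by
        rw [← hsq, norm_mul, RCLike.norm_conj, sq]
    _ ≤ ∑ h, if Q.polarBilin h = 0 then (Fintype.card V : ℝ) else 0 := by
        refine norm_sum_le_of_le _ fun h _ => ?_
        rw [norm_mul, AddChar.norm_apply, one_mul, sum_addChar_linearMap hψ]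
        split_ifs <;> simp
    _ = #{h | Q.polarBilin h = 0} * Fintype.card V := by
        rw [← Finset.sum_filter, Finset.sum_const, nsmul_eq_mul]

variable [Fintype F]

theorem norm_sum_addChar_quadraticForm_le (hψ : ψ ≠ 0) (Q : QuadraticForm F V) (L : V →ₗ[F] F)
    {m : ℕ} (hm : 2 * m ≤ finrank F (LinearMap.range Q.polarBilin)) :
    ‖∑ v, ψ (Q v + L v)‖ ≤ Fintype.card V / (Fintype.card F : ℝ) ^ m := by
  classical
  have : (0 : ℝ) < Fintype.card F := Nat.cast_pos.2 Fintype.card_pos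
  have hker : (#{h | Q.polarBilin h = 0} : ℝ) * Fintype.card F ^ (2 * m) ≤ Fintype.card V := by
    exact_mod_cast card_fiber_mul_pow_le Q.polarBilin 0 hm
  rw [le_div_iff₀ (by positivity)]
  refine (sq_le_sq₀ (by positivity) (by positivity)).1 ?_
  calc (‖∑ v, ψ (Q v + L v)‖ * (Fintype.card F : ℝ) ^ m) ^ 2
      = ‖∑ v, ψ (Q v + L v)‖ ^ 2 * (Fintype.card F : ℝ) ^ (2 * m) := by ring
    _ ≤ #{h | Q.polarBilin h = 0} * Fintype.card V * (Fintype.card F : ℝ) ^ (2 * m) := by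
        gcongr
        exact norm_sum_addChar_quadraticForm_sq_le hψ Q L
    _ = (#{h | Q.polarBilin h = 0} * (Fintype.card F : ℝ) ^ (2 * m)) * Fintype.card V := by ring
    _ ≤ Fintype.card V * Fintype.card V := by gcongr
    _ = (Fintype.card V : ℝ) ^ 2 := by ring

theorem abs_card_quadratic_system_sub_le [DecidableEq F] {J I : Type*} [Fintype J] [Fintype I]
    (Q : J → QuadraticForm F V) (L : J → V →ₗ[F] F) (T : I → V →ₗ[F] F) {m : ℕ}
    (hQ : ∀ c : J → F, c ≠ 0 →
      2 * m ≤ finrank F (LinearMap.range (∑ j, c j • Q j).polarBilin))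
    (hT : LinearIndependent F T) (u : J → F) (t : I → F) :
    |(#{v | (∀ j, Q j v + L j v = u j) ∧ ∀ i, T i v = t i} : ℝ) -
        Fintype.card V / Fintype.card F ^ (Fintype.card J + Fintype.card I)| ≤
      Fintype.card V / (Fintype.card F : ℝ) ^ m := by
  classical
  obtain ⟨ψ, hψ⟩ : ∃ ψ : AddChar F ℂ, ψ 1 ≠ 1 := AddChar.exists_apply_ne_zero.2 one_ne_zero
  replace hψ : ψ ≠ 0 := AddChar.ne_zero_iff.2 ⟨1, hψ⟩
  let Φ : V → J ⊕ I → F := fun v => Sum.elim (fun j => Q j v + L j v) fun i => T i v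
  have hΦ : ∀ c : J ⊕ I → F, c ≠ 0 →
      ‖∑ v, ψ (c ⬝ᵥ Φ v)‖ ≤ Fintype.card V / (Fintype.card F : ℝ) ^ m := by
    intro c hc
    obtain ⟨a, b, rfl⟩ : ∃ a b, c = Sum.elim a b := ⟨_, _, (Sum.elim_comp_inl_inr c).symm⟩
    have hphase : ∀ v, Sum.elim a b ⬝ᵥ Φ v =
        (∑ j, a j • Q j) v + (∑ j, a j • L j + ∑ i, b i • T i) v := fun v => by
      simp [Φ, dotProduct, mul_add, Finset.sum_add_distrib, add_assoc]
    simp only [hphase]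
    by_cases ha : a = 0
    · have hb : ∑ i, b i • T i ≠ 0 := fun hb => hc <| by
        have hb0 : b = 0 := funext (Fintype.linearIndependent_iff.1 hT b hb)
        rw [ha, hb0, Sum.elim_zero_zero]
      simp only [ha, Pi.zero_apply, zero_smul, Finset.sum_const_zero, zero_add,
        zero_apply]
      rw [sum_addChar_linearMap hψ, if_neg hb, norm_zero]
      positivity
    · exact norm_sum_addChar_quadraticForm_le hψ _ _ (hQ a ha)
  simpa [Φ, funext_iff, Sum.forall] using abs_card_fiber_sub_le_of_norm_sum_addChar_le hψ Φ
    (by positivity) hΦ (Sum.elim u t)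

end Quadratic

end ExponentialSums

section GramSystems

open Module (finrank)

variable {F ι κ : Type*} [Field F] [Fintype ι]

theorem polar_sum_smul {V A : Type*} [AddCommGroup V] [Module F V] [Fintype A] (c : A → F)
    (Q : A → QuadraticForm F V) (v w : V) :
    QuadraticMap.polar (∑ a, c a • Q a : QuadraticForm F V) v w =
      ∑ a, c a * QuadraticMap.polar (Q a) v w := by
  simp [QuadraticMap.polar, mul_sub]

/-- The linear form `v ↦ v_s · r` on the space `(F^ι)^κ` of tuples of vectors. -/
def coordFunctional (r : ι → F) (s : κ) : (κ → ι → F) →ₗ[F] F :=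
  (dotProductBilin F F).flip r ∘ₗ LinearMap.proj s

@[simp]
theorem coordFunctional_apply (r : ι → F) (s : κ) (v : κ → ι → F) :
    coordFunctional r s v = v s ⬝ᵥ r :=
  rfl

theorem linearIndependent_coordFunctional {K : Type*} [Finite κ] [Finite K] {R : K → ι → F}
    (hR : LinearIndependent F R) :
    LinearIndependent F fun a : κ × K => coordFunctional (R a.2) a.1 := by
  classical
  have := Fintype.ofFinite κ
  have := Fintype.ofFinite K
  rw [Fintype.linearIndependent_iff] at hR ⊢
  rintro c hc ⟨s, k⟩
  refine hR (fun k => c (s, k)) (dotProduct_eq_zero _ fun x => ?_) k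
  have hx := DFunLike.congr_fun hc (Pi.single s x)
  rw [LinearMap.sum_apply, Fintype.sum_prod_type, Fintype.sum_eq_single s fun s' hs => by
    simp [hs]] at hx
  simpa [dotProduct_sum, dotProduct_comm] using hx

theorem rank_le_finrank_range_of_apply_eq_dotProduct_mulVec {V : Type*} [AddCommGroup V]
    [Module F V] [FiniteDimensional F V] (D : V →ₗ[F] V →ₗ[F] F) (f g : (ι → F) →ₗ[F] V)
    {M : Matrix ι ι F} (hM : ∀ x y, D (f x) (g y) = x ⬝ᵥ M *ᵥ y) :
    M.rank ≤ finrank F (LinearMap.range D) := by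
  classical
  let A : (V →ₗ[F] F) →ₗ[F] ι → F := LinearMap.pi fun i => LinearMap.applyₗ (g (Pi.single i 1))
  have hfactor : Mᵀ.mulVecLin = A ∘ₗ D ∘ₗ f := by
    refine LinearMap.ext fun x => funext fun i => ?_
    change (Mᵀ *ᵥ x) i = D (f x) (g (Pi.single i 1))
    rw [hM, Matrix.mulVec_transpose, Matrix.mulVec_single_one]
    rfl
  calc M.rank = finrank F (LinearMap.range (A ∘ₗ D ∘ₗ f)) := by
        rw [← Matrix.rank_transpose, Matrix.rank, hfactor]
    _ ≤ finrank F (LinearMap.range (D ∘ₗ f)) := by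
        rw [LinearMap.range_comp]
        exact Submodule.finrank_map_le A _
    _ ≤ finrank F (LinearMap.range D) := Submodule.finrank_mono (LinearMap.range_comp_le_range f D)

section PairForm

variable [DecidableEq ι]

/-- The quadratic form `v ↦ v_sᵀ M v_t` on `(F^ι)^κ`. It turns a bilinear condition on the pair
`(v_s, v_t)`, or a quadratic one if `s = t`, into a quadratic condition on the whole tuple `v`. -/
def pairForm (M : Matrix ι ι F) (s t : κ) : QuadraticForm F (κ → ι → F) :=
  LinearMap.BilinMap.toQuadraticMap
    ((Matrix.toLinearMap₂' F M).compl₁₂ (LinearMap.proj s) (LinearMap.proj t))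

@[simp]
theorem pairForm_apply (M : Matrix ι ι F) (s t : κ) (v : κ → ι → F) :
    pairForm M s t v = v s ⬝ᵥ M *ᵥ v t := by
  simp [pairForm, Matrix.toLinearMap₂'_apply']

@[simp]
theorem polar_pairForm (M : Matrix ι ι F) (s t : κ) (v w : κ → ι → F) :
    QuadraticMap.polar (pairForm M s t) v w = v s ⬝ᵥ M *ᵥ w t + w s ⬝ᵥ M *ᵥ v t := by
  simp [pairForm, LinearMap.BilinMap.polar_toQuadraticMap, Matrix.toLinearMap₂'_apply']

theorem polar_pairForm_single_of_ne [DecidableEq κ] (M : Matrix ι ι F) {s t s' t' : κ}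
    (h : s(s, t) ≠ s(s', t')) (x y : ι → F) :
    QuadraticMap.polar (pairForm M s t) (Pi.single s' x) (Pi.single t' y) = 0 := by
  have hst : s = s' → t ≠ t' := fun hs ht => h (by rw [hs, ht])
  have hts : s = t' → t ≠ s' := fun hs ht => h (by rw [hs, ht, Sym2.eq_swap])
  rw [polar_pairForm]
  by_cases h₁ : s = s' <;> by_cases h₂ : s = t' <;> simp_all

theorem polar_pairForm_single_self [DecidableEq κ] {M : Matrix ι ι F} (hM : M.IsSymm)
    (s t : κ) (x y : ι → F) :
    QuadraticMap.polar (pairForm M s t) (Pi.single s x) (Pi.single t y) =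
      (if s = t then 2 else 1) * (x ⬝ᵥ M *ᵥ y) := by
  split_ifs with h
  · subst h
    rw [polar_pairForm, Pi.single_eq_same, Pi.single_eq_same, Matrix.dotProduct_mulVec y,
      ← Matrix.mulVec_transpose, hM.eq, dotProduct_comm (M *ᵥ y), two_mul]
  · simp [h]

variable {P J : Type*} [Fintype P] [Fintype J]

theorem polar_sum_pairForm_single [DecidableEq κ] {M : J → Matrix ι ι F} (hM : ∀ j, (M j).IsSymm)
    {s t : P → κ} (hst : Function.Injective fun a => s(s a, t a)) (c : P × J → F) (a : P)
    (x y : ι → F) :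
    QuadraticMap.polar (∑ b, c b • pairForm (M b.2) (s b.1) (t b.1) : QuadraticForm F (κ → ι → F))
      (Pi.single (s a) x) (Pi.single (t a) y) =
      x ⬝ᵥ ((if s a = t a then 2 else 1 : F) • ∑ j, c (a, j) • M j) *ᵥ y := by
  have hother : ∀ b ≠ a, ∑ j, c (b, j) * QuadraticMap.polar (pairForm (M j) (s b) (t b))
      (Pi.single (s a) x) (Pi.single (t a) y) = 0 := fun b hb =>
    Finset.sum_eq_zero fun j _ => by rw [polar_pairForm_single_of_ne _ (hst.ne hb), mul_zero]
  rw [polar_sum_smul, Fintype.sum_prod_type, Fintype.sum_eq_single a hother]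
  simp only [polar_pairForm_single_self (hM _), Matrix.smul_mulVec, Matrix.sum_mulVec,
    dotProduct_smul, dotProduct_sum, smul_eq_mul, Finset.mul_sum, mul_left_comm]

theorem le_finrank_range_polarBilin_sum_pairForm [Finite κ] (h2 : (2 : F) ≠ 0)
    {M : J → Matrix ι ι F} (hM : ∀ j, (M j).IsSymm) {r : ℕ}
    (hr : ∀ c : J → F, c ≠ 0 → r ≤ (∑ j, c j • M j).rank) {s t : P → κ}
    (hst : Function.Injective fun a => s(s a, t a)) {c : P × J → F} (hc : c ≠ 0) :
    r ≤ finrank F (LinearMap.range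
      (∑ a, c a • pairForm (M a.2) (s a.1) (t a.1)).polarBilin) := by
  classical
  obtain ⟨⟨a, j⟩, haj⟩ := Function.ne_iff.1 hc
  let k : F := if s a = t a then 2 else 1
  have hk : k ≠ 0 := by simp only [k]; split_ifs <;> simp [h2]
  calc r ≤ (∑ j, c (a, j) • M j).rank := hr _ fun h => haj (congr_fun h j)
    _ = (k • ∑ j, c (a, j) • M j).rank :=
        (Matrix.rank_smul_of_mem_nonZeroDivisors _ (mem_nonZeroDivisors_of_ne_zero hk)).symm
    _ ≤ _ := rank_le_finrank_range_of_apply_eq_dotProduct_mulVec _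
        (LinearMap.single F (fun _ => ι → F) (s a)) (LinearMap.single F (fun _ => ι → F) (t a))
        fun x y => polar_sum_pairForm_single hM hst c a x y

theorem abs_card_pairForm_system_sub_le [Fintype F] [DecidableEq F] [Fintype κ]
    [DecidableEq κ] {I : Type*} [Fintype I] (h2 : (2 : F) ≠ 0) {M : J → Matrix ι ι F}
    (hM : ∀ j, (M j).IsSymm) {m : ℕ}
    (hm : ∀ c : J → F, c ≠ 0 → 2 * m ≤ (∑ j, c j • M j).rank) {s t : P → κ}
    (hst : Function.Injective fun a => s(s a, t a)) (L : P → J → (κ → ι → F) →ₗ[F] F)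
    {T : I → (κ → ι → F) →ₗ[F] F} (hT : LinearIndependent F T) (U : P → J → F) (u : I → F) :
    |(#{v : κ → ι → F | (∀ a j, v (s a) ⬝ᵥ M j *ᵥ v (t a) + L a j v = U a j) ∧
        ∀ i, T i v = u i} : ℝ) -
        Fintype.card (κ → ι → F) /
          Fintype.card F ^ (Fintype.card P * Fintype.card J + Fintype.card I)| ≤
      Fintype.card (κ → ι → F) / (Fintype.card F : ℝ) ^ m := by
  simpa [Prod.forall] using abs_card_quadratic_system_sub_le
    (fun a : P × J => pairForm (M a.2) (s a.1) (t a.1)) (fun a => L a.1 a.2) T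
    (fun c hc => le_finrank_range_polarBilin_sum_pairForm h2 hM hm hst hc) hT (fun a => U a.1 a.2) u

end PairForm

end GramSystems

section NormedProducts

theorem norm_iterate_starRingEnd (k : ℕ) (z : ℂ) : ‖(starRingEnd ℂ)^[k] z‖ = ‖z‖ := by
  induction k with
  | zero => rfl
  | succ k ih => rw [Function.iterate_succ_apply', RCLike.norm_conj, ih]

theorem norm_prod_le_of_mem {ι R : Type*} [NormedField R] {s : Finset ι} {f : ι → R} {i : ι}
    (hi : i ∈ s) (hf : ∀ j ∈ s, ‖f j‖ ≤ 1) : ‖∏ j ∈ s, f j‖ ≤ ‖f i‖ := by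
  classical
  rw [norm_prod, ← Finset.mul_prod_erase _ _ hi]
  exact mul_le_of_le_one_right (norm_nonneg _)
    (Finset.prod_le_one (fun _ _ => norm_nonneg _) fun j hj => hf j (Finset.mem_of_mem_erase hj))

end NormedProducts

section Densities

variable {V : Type*} [DecidableEq V]

theorem prod_prod_charMeasure [Fintype V] {I J : Type*} [Fintype I] [Fintype J]
    (β : Finset (V × V)) (x : I → V) (y : J → V) :
    ∏ i, ∏ j, charMeasure β (x i) (y j) =
      if ∀ i j, (x i, y j) ∈ β then
        ((Fintype.card V : ℝ) ^ 2 / #β) ^ (Fintype.card I * Fintype.card J) else 0 := by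
  simp only [charMeasure, Finset.prod_ite_zero, Finset.prod_const, Finset.mem_univ, true_imp_iff,
    Finset.card_univ, ← pow_mul, mul_comm (Fintype.card J)]

theorem density_nonneg (A S : Finset V) : 0 ≤ density A S := by
  unfold density
  positivity

theorem density_le_one (A S : Finset V) : density A S ≤ 1 :=
  div_le_one_of_le₀ (Nat.cast_le.2 (Finset.card_le_card Finset.inter_subset_right))
    (Nat.cast_nonneg _)

theorem density_mul_card (A S : Finset V) : density A S * #S = #(A ∩ S) := by
  refine div_mul_cancel_of_imp fun hS => ?_
  rw [Nat.cast_eq_zero, Finset.card_eq_zero] at hS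
  simp [hS]

theorem norm_indicator_sub_density_le_one (A S : Finset V) (w : V) :
    ‖(if w ∈ A then 1 else 0 : ℂ) - density A S‖ ≤ 1 := by
  have h₀ := density_nonneg A S
  have h₁ := density_le_one A S
  split_ifs
  · rw [← Complex.ofReal_one, ← Complex.ofReal_sub, Complex.norm_real,
      Real.norm_of_nonneg (sub_nonneg.2 h₁)]
    linarith
  · rwa [zero_sub, norm_neg, Complex.norm_real, Real.norm_of_nonneg h₀]

theorem sum_norm_indicator_sub_density_le (A S : Finset V) :
    ∑ w ∈ S, ‖(if w ∈ A then 1 else 0 : ℂ) - density A S‖ ≤ 2 * density A S * #S := by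
  calc ∑ w ∈ S, ‖(if w ∈ A then 1 else 0 : ℂ) - density A S‖
      ≤ ∑ w ∈ S, ((if w ∈ A then 1 else 0) + density A S) := by
        refine Finset.sum_le_sum fun w _ => (norm_sub_le _ _).trans_eq ?_
        rw [Complex.norm_real, Real.norm_of_nonneg (density_nonneg A S), apply_ite norm, norm_one,
          norm_zero]
    _ = #(A ∩ S) + density A S * #S := by
        rw [Finset.sum_add_distrib, Finset.sum_boole, Finset.filter_mem_eq_inter,
          Finset.inter_comm, Finset.sum_const, nsmul_eq_mul, mul_comm]
    _ = 2 * density A S * #S := by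
        rw [← density_mul_card]
        ring

end Densities

namespace QuadraticFactor

variable {p n ℓ q : ℕ}

theorem le_rank_iff {𝓑 : QuadraticFactor p n ℓ q} {r : ℕ} :
    (r : ℕ∞) ≤ 𝓑.rank ↔ ∀ c : Fin q → ZMod p, c ≠ 0 → r ≤ (∑ j, c j • 𝓑.M j).rank := by
  simp [rank]

theorem natCast_le_rank {𝓑 : QuadraticFactor p n ℓ q} {r s : ℕ} (hr : (r : ℕ∞) ≤ 𝓑.rank)
    (h : s ≤ r) : (s : ℕ∞) ≤ 𝓑.rank :=
  (Nat.cast_le.2 h).trans hr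

theorem natCast_le_rank_of_ofReal_le {𝓑 : QuadraticFactor p n ℓ q} {r : ℕ} {t : ℝ}
    (hrank : ENNReal.ofReal t ≤ (𝓑.rank : ℝ≥0∞)) (ht : 0 < q → (r : ℝ) ≤ t) :
    (r : ℕ∞) ≤ 𝓑.rank := by
  rcases Nat.eq_zero_or_pos q with rfl | hq
  · exact le_rank_iff.2 fun c hc => absurd (Subsingleton.elim c 0) hc
  · have hofReal := (ENNReal.ofReal_le_ofReal (ht hq)).trans hrank
    rw [ENNReal.ofReal_natCast] at hofReal
    exact_mod_cast hofReal

theorem dotProduct_mulVec_comm (𝓑 : QuadraticFactor p n ℓ q) (j : Fin q)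
    (x y : Fin n → ZMod p) : x ⬝ᵥ 𝓑.M j *ᵥ y = y ⬝ᵥ 𝓑.M j *ᵥ x := by
  rw [Matrix.dotProduct_mulVec, ← Matrix.mulVec_transpose, 𝓑.isSymm, dotProduct_comm]

variable [Fact p.Prime] {𝓑 : QuadraticFactor p n ℓ q}

theorem mem_atom {a : AtomLabel p ℓ q} {x : Fin n → ZMod p} :
    x ∈ 𝓑.atom a ↔ (∀ i, x ⬝ᵥ 𝓑.r i = a.1 i) ∧ ∀ j, x ⬝ᵥ 𝓑.M j *ᵥ x = a.2 j := by
  simp [atom]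

theorem mem_bilinearLevelSet {b : Fin q → ZMod p} {x y : Fin n → ZMod p} :
    (x, y) ∈ 𝓑.bilinearLevelSet b ↔ ∀ j, x ⬝ᵥ 𝓑.M j *ᵥ y = b j := by
  simp [bilinearLevelSet]

theorem abs_card_atom_sub_le (h2 : (2 : ZMod p) ≠ 0) {m : ℕ}
    (hm : ((2 * m : ℕ) : ℕ∞) ≤ 𝓑.rank) (a : AtomLabel p ℓ q) :
    |(#(𝓑.atom a) : ℝ) - (p : ℝ) ^ n / (p : ℝ) ^ (q + ℓ)| ≤ (p : ℝ) ^ n / (p : ℝ) ^ m := by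
  have hcount := abs_card_pairForm_system_sub_le (κ := Fin 1) (s := fun _ : Unit => 0)
    (t := fun _ => 0) h2 𝓑.isSymm (le_rank_iff.1 hm) (Function.injective_of_subsingleton _) 0
    (LinearIndependent.comp (linearIndependent_coordFunctional 𝓑.linearIndependent)
      (fun i => (0, i)) fun _ _ h => congrArg Prod.snd h) (fun _ => a.2) a.1
  rw [Finset.card_equiv (t := 𝓑.atom a) (Equiv.funUnique (Fin 1) (Fin n → ZMod p)) fun v => by
    simp [mem_atom, and_comm]] at hcount
  simpa [ZMod.card] using hcount

theorem abs_card_bilinearLevelSet_sub_le (h2 : (2 : ZMod p) ≠ 0) {m : ℕ}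
    (hm : ((2 * m : ℕ) : ℕ∞) ≤ 𝓑.rank) (b : Fin q → ZMod p) :
    |(#(𝓑.bilinearLevelSet b) : ℝ) - ((p : ℝ) ^ n) ^ 2 / (p : ℝ) ^ q| ≤
      ((p : ℝ) ^ n) ^ 2 / (p : ℝ) ^ m := by
  have hcount := abs_card_pairForm_system_sub_le (κ := Fin 2) (s := fun _ : Unit => 0)
    (t := fun _ => 1) h2 𝓑.isSymm (le_rank_iff.1 hm) (Function.injective_of_subsingleton _) 0
    (linearIndependent_empty_type (v := Empty.elim)) (fun _ => b) Empty.elim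
  rw [Finset.card_equiv (t := 𝓑.bilinearLevelSet b) (finTwoArrowEquiv _) fun v => by
    simp [bilinearLevelSet]] at hcount
  simpa [ZMod.card] using hcount

/-- The points `w` for which the vectors `M_j w` are linearly independent of one another and of
the `r_i`; over such `w` the fibres of `(x, y, z) ↦ x₀ + y₀ + z₀` on the configurations below are
cut out by independent equations. -/
def IsGeneric (𝓑 : QuadraticFactor p n ℓ q) (w : Fin n → ZMod p) : Prop :=
  LinearIndependent (ZMod p) (Sum.elim 𝓑.r fun j => 𝓑.M j *ᵥ w)

theorem exists_sum_smul_mulVec_eq_of_not_isGeneric {w : Fin n → ZMod p}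
    (hw : ¬ 𝓑.IsGeneric w) : ∃ (c : Fin q → ZMod p) (e : Fin ℓ → ZMod p),
      c ≠ 0 ∧ (∑ j, c j • 𝓑.M j) *ᵥ w = ∑ i, e i • 𝓑.r i := by
  rw [IsGeneric, Fintype.not_linearIndependent_iff] at hw
  obtain ⟨g, hg, i, hi⟩ := hw
  simp only [Fintype.sum_sum_type, Sum.elim_inl, Sum.elim_inr] at hg
  refine ⟨fun j => g (.inr j), fun i => -g (.inl i), fun hc => hi ?_, ?_⟩
  · have hc' : ∀ j, g (.inr j) = 0 := congr_fun hc
    simp only [hc', zero_smul, Finset.sum_const_zero, add_zero] at hg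
    exact i.rec (Fintype.linearIndependent_iff.1 𝓑.linearIndependent _ hg) hc'
  · simp only [Matrix.sum_mulVec, Matrix.smul_mulVec, neg_smul, Finset.sum_neg_distrib]
    exact (neg_eq_of_add_eq_zero_right hg).symm

open Classical in
theorem card_not_isGeneric_mul_pow_le {r : ℕ} (hr : (r : ℕ∞) ≤ 𝓑.rank) :
    #{w | ¬ 𝓑.IsGeneric w} * p ^ r ≤ p ^ (q + ℓ) * p ^ n := by
  let solutions (ce : (Fin q → ZMod p) × (Fin ℓ → ZMod p)) : Finset (Fin n → ZMod p) :=
    {w | ce.1 ≠ 0 ∧ (∑ j, ce.1 j • 𝓑.M j) *ᵥ w = ∑ i, ce.2 i • 𝓑.r i}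
  have hcard (ce) : #(solutions ce) * p ^ r ≤ p ^ n := by
    by_cases hc : ce.1 = 0
    · simp [solutions, hc]
    · simpa [solutions, hc, ZMod.card, Matrix.sum_mulVec, Matrix.smul_mulVec] using
        card_fiber_mul_pow_le (∑ j, ce.1 j • 𝓑.M j).mulVecLin (∑ i, ce.2 i • 𝓑.r i)
          (le_rank_iff.1 hr _ hc)
  have hcover : ({w | ¬ 𝓑.IsGeneric w} : Finset _) ⊆ Finset.univ.biUnion solutions := by
    intro w hw
    obtain ⟨c, e, hce⟩ := exists_sum_smul_mulVec_eq_of_not_isGeneric (Finset.mem_filter.1 hw).2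
    exact Finset.mem_biUnion.2 ⟨(c, e), Finset.mem_univ _, by simpa [solutions] using hce⟩
  calc #{w | ¬ 𝓑.IsGeneric w} * p ^ r
      ≤ (∑ ce, #(solutions ce)) * p ^ r := by
        gcongr
        exact (Finset.card_le_card hcover).trans Finset.card_biUnion_le
    _ ≤ ∑ _ce : (Fin q → ZMod p) × (Fin ℓ → ZMod p), p ^ n := by
        rw [Finset.sum_mul]
        exact Finset.sum_le_sum fun ce _ => hcard ce
    _ = p ^ (q + ℓ) * p ^ n := by simp [ZMod.card, pow_add]

/-- The configurations `(x, y, z)`, consisting of two points in each of the three atoms, which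
carry the weight of the local `U³(d)` inner product. -/
def configurations (𝓑 : QuadraticFactor p n ℓ q) (d : TripleLabel p ℓ q) :
    Finset ((Fin 2 → Fin n → ZMod p) × (Fin 2 → Fin n → ZMod p) × (Fin 2 → Fin n → ZMod p)) :=
  {v ∈ Fintype.piFinset (fun _ => 𝓑.atom d.a₁) ×ˢ Fintype.piFinset (fun _ => 𝓑.atom d.a₂) ×ˢ
      Fintype.piFinset (fun _ => 𝓑.atom d.a₃) |
    (∀ i j, (v.1 i, v.2.1 j) ∈ 𝓑.bilinearLevelSet d.b₁₂) ∧
    (∀ i k, (v.1 i, v.2.2 k) ∈ 𝓑.bilinearLevelSet d.b₁₃) ∧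
    ∀ j k, (v.2.1 j, v.2.2 k) ∈ 𝓑.bilinearLevelSet d.b₂₃}

theorem mem_configurations {d : TripleLabel p ℓ q} {x y z : Fin 2 → Fin n → ZMod p} :
    (x, y, z) ∈ 𝓑.configurations d ↔
      ((∀ i, x i ∈ 𝓑.atom d.a₁) ∧ (∀ i, y i ∈ 𝓑.atom d.a₂) ∧ ∀ i, z i ∈ 𝓑.atom d.a₃) ∧
      (∀ i j, (x i, y j) ∈ 𝓑.bilinearLevelSet d.b₁₂) ∧
      (∀ i k, (x i, z k) ∈ 𝓑.bilinearLevelSet d.b₁₃) ∧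
      ∀ j k, (y j, z k) ∈ 𝓑.bilinearLevelSet d.b₂₃ := by
  simp [configurations]

theorem add_add_mem_atom_sigma {d : TripleLabel p ℓ q} {x y z : Fin 2 → Fin n → ZMod p}
    (h : (x, y, z) ∈ 𝓑.configurations d) (i j k : Fin 2) :
    x i + y j + z k ∈ 𝓑.atom d.sigma := by
  simp only [mem_configurations, mem_atom, mem_bilinearLevelSet] at h ⊢
  obtain ⟨⟨hx, hy, hz⟩, hxy, hxz, hyz⟩ := h
  refine ⟨fun e => ?_, fun e => ?_⟩
  · simp [TripleLabel.sigma, hx, hy, hz]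
  · simp only [TripleLabel.sigma, add_dotProduct, Matrix.mulVec_add, dotProduct_add,
      𝓑.dotProduct_mulVec_comm e (y j) (x i), 𝓑.dotProduct_mulVec_comm e (z k) (x i),
      𝓑.dotProduct_mulVec_comm e (z k) (y j), hx, hy, hz, hxy, hxz, hyz, Prod.snd_add,
      Pi.add_apply, two_smul]
    ring

/-- The configurations with `x₀ + y₀ + z₀ = w`. -/
def configurationFiber (𝓑 : QuadraticFactor p n ℓ q) (d : TripleLabel p ℓ q)
    (w : Fin n → ZMod p) :
    Finset ((Fin 2 → Fin n → ZMod p) × (Fin 2 → Fin n → ZMod p) × (Fin 2 → Fin n → ZMod p)) :=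
  {v ∈ 𝓑.configurations d | v.1 0 + v.2.1 0 + v.2.2 0 = w}

theorem mem_configurationFiber {d : TripleLabel p ℓ q} {w : Fin n → ZMod p}
    {x y z : Fin 2 → Fin n → ZMod p} :
    (x, y, z) ∈ 𝓑.configurationFiber d w ↔
      (x, y, z) ∈ 𝓑.configurations d ∧ x 0 + y 0 + z 0 = w := by
  simp [configurationFiber]

theorem card_configurationFiber_le {d : TripleLabel p ℓ q} {w : Fin n → ZMod p}
    {S : Finset (Fin 5 → Fin n → ZMod p)}
    (hS : ∀ x y z, (x, y, z) ∈ 𝓑.configurationFiber d w → ![x 0, y 0, x 1, y 1, z 1] ∈ S) :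
    #(𝓑.configurationFiber d w) ≤ #S := by
  refine Finset.card_le_card_of_injOn (fun v => ![v.1 0, v.2.1 0, v.1 1, v.2.1 1, v.2.2 1])
    (fun v => hS v.1 v.2.1 v.2.2) ?_
  rintro ⟨x, y, z⟩ h ⟨x', y', z'⟩ h' heq
  obtain ⟨-, hsum⟩ := mem_configurationFiber.1 h
  obtain ⟨-, hsum'⟩ := mem_configurationFiber.1 h'
  simp only [Matrix.vecCons_inj, and_true] at heq
  obtain ⟨hx₀, hy₀, hx₁, hy₁, hz₁⟩ := heq
  have hz₀ : z 0 = z' 0 := by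
    rw [← eq_sub_iff_add_eq'] at hsum hsum'
    rw [hsum, hsum', hx₀, hy₀]
  simp only [Prod.mk.injEq, funext_iff (α := Fin 2), Fin.forall_fin_two]
  exact ⟨⟨hx₀, hx₁⟩, ⟨hy₀, hy₁⟩, hz₀, hz₁⟩

theorem card_configurationFiber_le_pow (d : TripleLabel p ℓ q) (w : Fin n → ZMod p) :
    #(𝓑.configurationFiber d w) ≤ (p ^ n) ^ 5 := by
  simpa [ZMod.card] using card_configurationFiber_le (S := Finset.univ) (d := d) (w := w)
    (𝓑 := 𝓑) fun _ _ _ _ => Finset.mem_univ _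

/-- The values, on a configuration, of the left-hand sides of the quadratic equations defining
`fiberSolutions`; the rows and columns are labelled by `x₀, y₀, x₁, y₁, z₁`, and only the entries
on and above the diagonal matter. -/
def gramValue (d : TripleLabel p ℓ q) : Fin 5 → Fin 5 → Fin q → ZMod p :=
  ![![d.a₁.2, d.b₁₂, -d.b₁₂ - d.b₁₃, d.b₁₂, d.b₁₃],
    ![0, d.a₂.2, d.b₁₂, -d.b₁₂ - d.b₂₃, d.b₂₃],
    ![0, 0, d.a₁.2, d.b₁₂, d.b₁₃],
    ![0, 0, 0, d.a₂.2, d.b₂₃],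
    ![0, 0, 0, 0, d.a₃.2]]

/-- The linear parts of the quadratic equations defining `fiberSolutions`. With
`z₀ = w - x₀ - y₀` the conditions `z₀ᵀ M_j x₁ = (b₁₃)_j` and `z₀ᵀ M_j y₁ = (b₂₃)_j` become equations
for `x₀ᵀ M_j x₁` and `y₀ᵀ M_j y₁` in which `wᵀ M_j x₁` and `wᵀ M_j y₁` appear. -/
def gramShift (𝓑 : QuadraticFactor p n ℓ q) (w : Fin n → ZMod p) (s t : Fin 5) (j : Fin q) :
    (Fin 5 → Fin n → ZMod p) →ₗ[ZMod p] ZMod p :=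
  if (s, t) = (0, 2) ∨ (s, t) = (1, 3) then -coordFunctional (𝓑.M j *ᵥ w) t else 0

/-- The linear equations defining `fiberSolutions`: the pairings of the five points with the `r_i`,
and those of `x₀` and `y₀` with the `M_j w`, which encode `x₀ᵀ M_j z₀` and `y₀ᵀ M_j z₀`. -/
def fiberFunctional (𝓑 : QuadraticFactor p n ℓ q) (w : Fin n → ZMod p) :
    (Fin 5 × Fin ℓ) ⊕ (Fin 2 × Fin q) → (Fin 5 → Fin n → ZMod p) →ₗ[ZMod p] ZMod p :=
  Sum.elim (fun a => coordFunctional (𝓑.r a.2) a.1)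
    fun a => coordFunctional (𝓑.M a.2 *ᵥ w) (a.1.castLE (by decide))

/-- The values of the functionals `fiberFunctional` on a configuration. -/
def fiberValue (d : TripleLabel p ℓ q) : (Fin 5 × Fin ℓ) ⊕ (Fin 2 × Fin q) → ZMod p :=
  Sum.elim (fun a => ![d.a₁.1, d.a₂.1, d.a₁.1, d.a₂.1, d.a₃.1] a.1 a.2)
    fun a => ![d.a₁.2 + d.b₁₂ + d.b₁₃, d.b₁₂ + d.a₂.2 + d.b₂₃] a.1 a.2

/-- The system of equations satisfied by `(x₀, y₀, x₁, y₁, z₁)` whenever `(x, y, z)` is a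
configuration with `x₀ + y₀ + z₀ = w`. -/
def fiberSolutions (𝓑 : QuadraticFactor p n ℓ q) (d : TripleLabel p ℓ q) (w : Fin n → ZMod p) :
    Finset (Fin 5 → Fin n → ZMod p) :=
  {v | (∀ (a : {a : Fin 5 × Fin 5 // a.1 ≤ a.2}) (j : Fin q),
      v a.1.1 ⬝ᵥ 𝓑.M j *ᵥ v a.1.2 + 𝓑.gramShift w a.1.1 a.1.2 j v = gramValue d a.1.1 a.1.2 j) ∧
    ∀ i, 𝓑.fiberFunctional w i v = fiberValue d i}

theorem IsGeneric.linearIndependent_fiberFunctional {w : Fin n → ZMod p} (hw : 𝓑.IsGeneric w) :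
    LinearIndependent (ZMod p) (𝓑.fiberFunctional w) := by
  let index : (Fin 5 × Fin ℓ) ⊕ (Fin 2 × Fin q) → Fin 5 × (Fin ℓ ⊕ Fin q) :=
    Sum.elim (Prod.map id .inl) (Prod.map (Fin.castLE (by decide)) .inr)
  have hindex : Function.Injective index :=
    (Function.injective_id.prodMap Sum.inl_injective).sumElim
      ((Fin.castLE_injective _).prodMap Sum.inr_injective) fun _ _ h =>
        Sum.inl_ne_inr (congrArg Prod.snd h)
  convert (linearIndependent_coordFunctional hw).comp index hindex using 1
  ext (a | a) <;> rfl

theorem card_fiberSolutions_le (h2 : (2 : ZMod p) ≠ 0) {m : ℕ}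
    (hm : ((2 * m : ℕ) : ℕ∞) ≤ 𝓑.rank) (d : TripleLabel p ℓ q) {w : Fin n → ZMod p}
    (hw : 𝓑.IsGeneric w) :
    (#(𝓑.fiberSolutions d w) : ℝ) ≤
      (((p : ℝ) ^ (5 * ℓ + 17 * q))⁻¹ + ((p : ℝ) ^ m)⁻¹) * ((p : ℝ) ^ n) ^ 5 := by
  have hpairs : Function.Injective fun a : {a : Fin 5 × Fin 5 // a.1 ≤ a.2} => s(a.1.1, a.1.2) :=
    Sym2.sortEquiv.symm.injective
  have hexponent : Fintype.card {a : Fin 5 × Fin 5 // a.1 ≤ a.2} * Fintype.card (Fin q) +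
      Fintype.card ((Fin 5 × Fin ℓ) ⊕ (Fin 2 × Fin q)) = 5 * ℓ + 17 * q := by
    rw [show Fintype.card {a : Fin 5 × Fin 5 // a.1 ≤ a.2} = 15 by decide]
    simp only [Fintype.card_sum, Fintype.card_prod, Fintype.card_fin]
    ring
  have hcount := abs_card_pairForm_system_sub_le h2 𝓑.isSymm (le_rank_iff.1 hm) hpairs
    (fun a => 𝓑.gramShift w a.1.1 a.1.2) hw.linearIndependent_fiberFunctional
    (fun a => gramValue d a.1.1 a.1.2) (fiberValue d)
  rw [hexponent, abs_sub_le_iff, sub_le_iff_le_add'] at hcount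
  refine le_of_eq_of_le (by unfold fiberSolutions; congr!) (hcount.1.trans_eq ?_)
  simp only [Fintype.card_fun, Fintype.card_fin, ZMod.card, Nat.cast_pow]
  ring

theorem mem_fiberSolutions {d : TripleLabel p ℓ q} {w : Fin n → ZMod p}
    {x y z : Fin 2 → Fin n → ZMod p} (h : (x, y, z) ∈ 𝓑.configurationFiber d w) :
    ![x 0, y 0, x 1, y 1, z 1] ∈ 𝓑.fiberSolutions d w := by
  simp only [mem_configurationFiber, mem_configurations, mem_atom, mem_bilinearLevelSet] at h
  obtain ⟨⟨⟨hx, hy, hz⟩, hxy, hxz, hyz⟩, rfl⟩ := h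
  have hyx := fun i k j => (𝓑.dotProduct_mulVec_comm j (y i) (x k)).trans (hxy k i j)
  have hxx := fun j => 𝓑.dotProduct_mulVec_comm j (x 1) (x 0)
  have hyy := fun j => 𝓑.dotProduct_mulVec_comm j (y 1) (y 0)
  refine Finset.mem_filter.2 ⟨Finset.mem_univ _, ?_, ?_⟩
  · rintro ⟨⟨s, t⟩, hst⟩ j
    fin_cases s <;> fin_cases t <;> first
      | exact absurd hst (by decide)
      | simp [gramShift, gramValue, hx, hy, hz, hxy, hxz, hyz, hyx, hxx, hyy, Matrix.mulVec_add,
          dotProduct_add] <;> ring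
  · rintro (⟨s, i⟩ | ⟨s, j⟩) <;> fin_cases s <;>
      simp [fiberFunctional, fiberValue, hx, hy, hz, hxy, hyx, hxz, hyz, Matrix.mulVec_add,
        dotProduct_add]

theorem card_configurationFiber_le_of_isGeneric (h2 : (2 : ZMod p) ≠ 0) {m : ℕ}
    (hm : ((2 * m : ℕ) : ℕ∞) ≤ 𝓑.rank) (d : TripleLabel p ℓ q) {w : Fin n → ZMod p}
    (hw : 𝓑.IsGeneric w) :
    (#(𝓑.configurationFiber d w) : ℝ) ≤
      (((p : ℝ) ^ (5 * ℓ + 17 * q))⁻¹ + ((p : ℝ) ^ m)⁻¹) * ((p : ℝ) ^ n) ^ 5 :=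
  (Nat.cast_le.2 (card_configurationFiber_le fun _ _ _ => mem_fiberSolutions)).trans
    (card_fiberSolutions_le h2 hm d hw)

theorem sum_configurations_eq_sum_card_mul (d : TripleLabel p ℓ q) (g : (Fin n → ZMod p) → ℝ) :
    ∑ v ∈ 𝓑.configurations d, g (v.1 0 + v.2.1 0 + v.2.2 0) =
      ∑ w ∈ 𝓑.atom d.sigma, #(𝓑.configurationFiber d w) * g w := by
  rw [← Finset.sum_fiberwise_of_maps_to fun v hv => add_add_mem_atom_sigma hv 0 0 0]
  refine Finset.sum_congr rfl fun w _ => ?_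
  rw [← nsmul_eq_mul, configurationFiber]
  exact Finset.sum_eq_card_nsmul fun v hv => by rw [(Finset.mem_filter.1 hv).2]

theorem sum_configurations_le (h2 : (2 : ZMod p) ≠ 0) {m : ℕ}
    (hm : ((2 * m : ℕ) : ℕ∞) ≤ 𝓑.rank) (d : TripleLabel p ℓ q) {g : (Fin n → ZMod p) → ℝ}
    (hg₀ : ∀ w, 0 ≤ g w) (hg₁ : ∀ w, g w ≤ 1) :
    ∑ v ∈ 𝓑.configurations d, g (v.1 0 + v.2.1 0 + v.2.2 0) ≤
      (((p : ℝ) ^ (5 * ℓ + 17 * q))⁻¹ + ((p : ℝ) ^ m)⁻¹) * ((p : ℝ) ^ n) ^ 5 *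
        ∑ w ∈ 𝓑.atom d.sigma, g w +
      (p : ℝ) ^ (q + ℓ) / (p : ℝ) ^ (2 * m) * ((p : ℝ) ^ n) ^ 6 := by
  classical
  have hp : (0 : ℝ) < p := Nat.cast_pos.2 (NeZero.pos p)
  set K : ℝ := (((p : ℝ) ^ (5 * ℓ + 17 * q))⁻¹ + ((p : ℝ) ^ m)⁻¹) * ((p : ℝ) ^ n) ^ 5
  have hfiber (w) : #(𝓑.configurationFiber d w) * g w ≤
      K * g w + if 𝓑.IsGeneric w then 0 else ((p : ℝ) ^ n) ^ 5 := by
    split_ifs with hw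
    · rw [add_zero]
      exact mul_le_mul_of_nonneg_right (card_configurationFiber_le_of_isGeneric h2 hm d hw) (hg₀ w)
    · have htrivial : (#(𝓑.configurationFiber d w) : ℝ) ≤ ((p : ℝ) ^ n) ^ 5 := by
        exact_mod_cast card_configurationFiber_le_pow d w
      exact (mul_le_of_le_one_right (Nat.cast_nonneg _) (hg₁ w)).trans
        (htrivial.trans (le_add_of_nonneg_left (mul_nonneg (by positivity) (hg₀ w))))
  have hexceptional : (#{w | ¬ 𝓑.IsGeneric w} : ℝ) ≤
      (p : ℝ) ^ (q + ℓ) / (p : ℝ) ^ (2 * m) * (p : ℝ) ^ n := by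
    rw [div_mul_eq_mul_div, le_div_iff₀ (by positivity)]
    exact_mod_cast card_not_isGeneric_mul_pow_le hm
  calc ∑ v ∈ 𝓑.configurations d, g (v.1 0 + v.2.1 0 + v.2.2 0)
      = ∑ w ∈ 𝓑.atom d.sigma, #(𝓑.configurationFiber d w) * g w :=
        sum_configurations_eq_sum_card_mul d g
    _ ≤ K * ∑ w ∈ 𝓑.atom d.sigma, g w +
          ∑ w ∈ 𝓑.atom d.sigma, if 𝓑.IsGeneric w then 0 else ((p : ℝ) ^ n) ^ 5 := by
        rw [Finset.mul_sum, ← Finset.sum_add_distrib]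
        exact Finset.sum_le_sum fun w _ => hfiber w
    _ ≤ K * ∑ w ∈ 𝓑.atom d.sigma, g w +
          ∑ w, if 𝓑.IsGeneric w then 0 else ((p : ℝ) ^ n) ^ 5 := by
        gcongr
        exact Finset.subset_univ _
    _ = K * ∑ w ∈ 𝓑.atom d.sigma, g w + #{w | ¬ 𝓑.IsGeneric w} * ((p : ℝ) ^ n) ^ 5 := by
        rw [Finset.sum_ite, Finset.sum_const_zero, zero_add, Finset.sum_const, nsmul_eq_mul]
    _ ≤ K * ∑ w ∈ 𝓑.atom d.sigma, g w +
          (p : ℝ) ^ (q + ℓ) / (p : ℝ) ^ (2 * m) * (p : ℝ) ^ n * ((p : ℝ) ^ n) ^ 5 := by gcongr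
    _ = _ := by ring

/-- The constant value on `𝓑.configurations d` of the product of the twelve characteristic
measures in the local `U³(d)` inner product. -/
noncomputable def configurationWeight (𝓑 : QuadraticFactor p n ℓ q) (d : TripleLabel p ℓ q) : ℝ :=
  (((p : ℝ) ^ n) ^ 2 / #(𝓑.bilinearLevelSet d.b₁₂)) ^ 4 *
    (((p : ℝ) ^ n) ^ 2 / #(𝓑.bilinearLevelSet d.b₁₃)) ^ 4 *
    (((p : ℝ) ^ n) ^ 2 / #(𝓑.bilinearLevelSet d.b₂₃)) ^ 4

theorem configurationWeight_nonneg (d : TripleLabel p ℓ q) : 0 ≤ 𝓑.configurationWeight d := by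
  unfold configurationWeight
  positivity

theorem prod_charMeasure_eq_ite (d : TripleLabel p ℓ q) (x y z : Fin 2 → Fin n → ZMod p) :
    (∏ i, ∏ j, charMeasure (𝓑.bilinearLevelSet d.b₁₂) (x i) (y j)) *
        (∏ i, ∏ k, charMeasure (𝓑.bilinearLevelSet d.b₁₃) (x i) (z k)) *
        (∏ j, ∏ k, charMeasure (𝓑.bilinearLevelSet d.b₂₃) (y j) (z k)) =
      if (∀ i j, (x i, y j) ∈ 𝓑.bilinearLevelSet d.b₁₂) ∧
          (∀ i k, (x i, z k) ∈ 𝓑.bilinearLevelSet d.b₁₃) ∧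
          ∀ j k, (y j, z k) ∈ 𝓑.bilinearLevelSet d.b₂₃ then
        𝓑.configurationWeight d else 0 := by
  simp only [prod_prod_charMeasure, ite_zero_mul_ite_zero, and_assoc, configurationWeight,
    Fintype.card_fun, Fintype.card_fin, ZMod.card, Nat.cast_pow, Nat.reduceMul]

theorem norm_weight_mul_prod_le {d : TripleLabel p ℓ q}
    {f : (Fin 3 → Fin 2) → (Fin n → ZMod p) → ℂ} (hf : ∀ ω w, ‖f ω w‖ ≤ 1)
    (x y z : Fin 2 → Fin n → ZMod p) :
    ‖(∏ i, ∏ j, (charMeasure (𝓑.bilinearLevelSet d.b₁₂) (x i) (y j) : ℂ)) *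
        (∏ i, ∏ k, (charMeasure (𝓑.bilinearLevelSet d.b₁₃) (x i) (z k) : ℂ)) *
        (∏ j, ∏ k, (charMeasure (𝓑.bilinearLevelSet d.b₂₃) (y j) (z k) : ℂ)) *
        ∏ ω : Fin 3 → Fin 2,
          (starRingEnd ℂ)^[∑ i, (ω i : ℕ)] (f ω (x (ω 0) + y (ω 1) + z (ω 2)))‖ ≤
      if (∀ i j, (x i, y j) ∈ 𝓑.bilinearLevelSet d.b₁₂) ∧
          (∀ i k, (x i, z k) ∈ 𝓑.bilinearLevelSet d.b₁₃) ∧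
          ∀ j k, (y j, z k) ∈ 𝓑.bilinearLevelSet d.b₂₃ then
        𝓑.configurationWeight d * ‖f 0 (x 0 + y 0 + z 0)‖ else 0 := by
  have hphase := norm_prod_le_of_mem (i := 0) (Finset.mem_univ _)
    fun (ω : Fin 3 → Fin 2) _ => (norm_iterate_starRingEnd (∑ i, (ω i : ℕ)) _).trans_le
      (hf ω (x (ω 0) + y (ω 1) + z (ω 2)))
  rw [norm_iterate_starRingEnd] at hphase
  simp only [← Complex.ofReal_prod, ← Complex.ofReal_mul, prod_charMeasure_eq_ite]
  split_ifs
  · rw [norm_mul, Complex.norm_real, Real.norm_of_nonneg (configurationWeight_nonneg d)]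
    exact mul_le_mul_of_nonneg_left hphase (configurationWeight_nonneg d)
  · rw [Complex.ofReal_zero, zero_mul, norm_zero]

theorem norm_localU3Inner_le (d : TripleLabel p ℓ q) {f : (Fin 3 → Fin 2) → (Fin n → ZMod p) → ℂ}
    (hf : ∀ ω w, ‖f ω w‖ ≤ 1) :
    ‖𝓑.localU3Inner d f‖ ≤
      𝓑.configurationWeight d * (∑ v ∈ 𝓑.configurations d, ‖f 0 (v.1 0 + v.2.1 0 + v.2.2 0)‖) /
        (#(𝓑.atom d.a₁) ^ 2 * #(𝓑.atom d.a₂) ^ 2 * #(𝓑.atom d.a₃) ^ 2) := by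
  calc ‖𝓑.localU3Inner d f‖
      ≤ 𝔼 x ∈ Fintype.piFinset fun _ : Fin 2 => 𝓑.atom d.a₁,
        𝔼 y ∈ Fintype.piFinset fun _ : Fin 2 => 𝓑.atom d.a₂,
        𝔼 z ∈ Fintype.piFinset fun _ : Fin 2 => 𝓑.atom d.a₃,
          if (∀ i j, (x i, y j) ∈ 𝓑.bilinearLevelSet d.b₁₂) ∧
              (∀ i k, (x i, z k) ∈ 𝓑.bilinearLevelSet d.b₁₃) ∧
              ∀ j k, (y j, z k) ∈ 𝓑.bilinearLevelSet d.b₂₃ then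
            𝓑.configurationWeight d * ‖f 0 (x 0 + y 0 + z 0)‖ else 0 :=
        (RCLike.norm_expect_le (K := ℂ)).trans <| Finset.expect_le_expect fun x _ =>
          (RCLike.norm_expect_le (K := ℂ)).trans <| Finset.expect_le_expect fun y _ =>
            (RCLike.norm_expect_le (K := ℂ)).trans <| Finset.expect_le_expect fun z _ =>
              norm_weight_mul_prod_le hf x y z
    _ = _ := by
        rw [configurations, Finset.mul_sum, Finset.sum_filter, Finset.sum_product]
        simp only [Finset.sum_product, Finset.expect_eq_sum_div_card, ← Finset.sum_div, div_div,
          Fintype.card_piFinset_const, Nat.cast_pow]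
        congr 1
        ring

/-- The number `pⁿ / p^(q+ℓ)` of points which an atom of a factor of high rank has up to a small
relative error. -/
noncomputable def expectedAtomCard (p n ℓ q : ℕ) : ℝ :=
  (p : ℝ) ^ n / (p : ℝ) ^ (q + ℓ)

theorem expectedAtomCard_pos : 0 < expectedAtomCard p n ℓ q := by
  have hp : (0 : ℝ) < p := Nat.cast_pos.2 (NeZero.pos p)
  unfold expectedAtomCard
  positivity

theorem abs_card_atom_sub_expectedAtomCard_le (h2 : (2 : ZMod p) ≠ 0) {N : ℕ}
    (hN : ((2 * (q + ℓ + N) : ℕ) : ℕ∞) ≤ 𝓑.rank) (a : AtomLabel p ℓ q) :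
    |(#(𝓑.atom a) : ℝ) - expectedAtomCard p n ℓ q| ≤
      ((p : ℝ) ^ N)⁻¹ * expectedAtomCard p n ℓ q := by
  refine (abs_card_atom_sub_le h2 hN a).trans_eq ?_
  rw [pow_add _ (q + ℓ), ← div_div, inv_mul_eq_div, expectedAtomCard]

theorem le_card_bilinearLevelSet (h2 : (2 : ZMod p) ≠ 0) {N : ℕ}
    (hN : ((2 * (q + N) : ℕ) : ℕ∞) ≤ 𝓑.rank) (b : Fin q → ZMod p) :
    (1 - ((p : ℝ) ^ N)⁻¹) * (((p : ℝ) ^ n) ^ 2 / (p : ℝ) ^ q) ≤ #(𝓑.bilinearLevelSet b) := by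
  have hcard := (abs_le.1 (abs_card_bilinearLevelSet_sub_le h2 hN b)).1
  rw [pow_add, ← div_div, ← inv_mul_eq_div ((p : ℝ) ^ N)] at hcard
  linarith

theorem configurationWeight_le (h2 : (2 : ZMod p) ≠ 0) {N : ℕ}
    (hN : ((2 * (q + N) : ℕ) : ℕ∞) ≤ 𝓑.rank) (hpN : ((p : ℝ) ^ N)⁻¹ ≤ 1 / 10)
    (d : TripleLabel p ℓ q) : 𝓑.configurationWeight d ≤ (10 / 9 * (p : ℝ) ^ q) ^ 12 := by
  have hp : (0 : ℝ) < p := Nat.cast_pos.2 (NeZero.pos p)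
  have hquot (b) : ((p : ℝ) ^ n) ^ 2 / #(𝓑.bilinearLevelSet b) ≤ 10 / 9 * (p : ℝ) ^ q := by
    have hcard : 9 / 10 * (((p : ℝ) ^ n) ^ 2 / (p : ℝ) ^ q) ≤ #(𝓑.bilinearLevelSet b) :=
      (mul_le_mul_of_nonneg_right (by linarith) (by positivity)).trans
        (le_card_bilinearLevelSet h2 hN b)
    rw [div_le_iff₀ (hcard.trans_lt' (by positivity))]
    calc ((p : ℝ) ^ n) ^ 2
        = 10 / 9 * (p : ℝ) ^ q * (9 / 10 * (((p : ℝ) ^ n) ^ 2 / (p : ℝ) ^ q)) := by field_simp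
      _ ≤ _ := by gcongr
  calc 𝓑.configurationWeight d
      ≤ (10 / 9 * (p : ℝ) ^ q) ^ 4 * (10 / 9 * (p : ℝ) ^ q) ^ 4 * (10 / 9 * (p : ℝ) ^ q) ^ 4 := by
        unfold configurationWeight
        gcongr <;> exact hquot _
    _ = _ := by ring

theorem sum_configurations_le_expectedAtomCard (h2 : (2 : ZMod p) ≠ 0) {N : ℕ}
    (hN : ((2 * (18 * (ℓ + q) + N) : ℕ) : ℕ∞) ≤ 𝓑.rank) (d : TripleLabel p ℓ q)
    {g : (Fin n → ZMod p) → ℝ} (hg₀ : ∀ w, 0 ≤ g w) (hg₁ : ∀ w, g w ≤ 1) :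
    ∑ v ∈ 𝓑.configurations d, g (v.1 0 + v.2.1 0 + v.2.2 0) ≤
      ((1 + ((p : ℝ) ^ N)⁻¹) * expectedAtomCard p n ℓ q ^ 5 * ∑ w ∈ 𝓑.atom d.sigma, g w +
        ((p : ℝ) ^ N)⁻¹ * expectedAtomCard p n ℓ q ^ 6) / ((p : ℝ) ^ q) ^ 12 := by
  have hp : (0 : ℝ) < p := Nat.cast_pos.2 (NeZero.pos p)
  have hp₁ : (1 : ℝ) ≤ p := Nat.one_le_cast.2 (NeZero.pos p)
  have hgeneric : ((p : ℝ) ^ (18 * (ℓ + q) + N))⁻¹ ≤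
      ((p : ℝ) ^ (5 * ℓ + 17 * q))⁻¹ * ((p : ℝ) ^ N)⁻¹ := by
    rw [← mul_inv, ← pow_add]
    gcongr
    omega
  have hexceptional : (p : ℝ) ^ (q + ℓ) / (p : ℝ) ^ (2 * (18 * (ℓ + q) + N)) ≤
      ((p : ℝ) ^ N)⁻¹ / (p : ℝ) ^ (6 * ℓ + 18 * q) := by
    rw [inv_eq_one_div, div_div, div_le_div_iff₀ (by positivity) (by positivity), one_mul,
      ← pow_add, ← pow_add]
    exact pow_le_pow_right₀ hp₁ (by omega)
  calc ∑ v ∈ 𝓑.configurations d, g (v.1 0 + v.2.1 0 + v.2.2 0)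
      ≤ (((p : ℝ) ^ (5 * ℓ + 17 * q))⁻¹ + ((p : ℝ) ^ (5 * ℓ + 17 * q))⁻¹ * ((p : ℝ) ^ N)⁻¹) *
            ((p : ℝ) ^ n) ^ 5 * ∑ w ∈ 𝓑.atom d.sigma, g w +
          ((p : ℝ) ^ N)⁻¹ / (p : ℝ) ^ (6 * ℓ + 18 * q) * ((p : ℝ) ^ n) ^ 6 := by
        refine (sum_configurations_le h2 hN d hg₀ hg₁).trans ?_
        gcongr
        exact Finset.sum_nonneg fun w _ => hg₀ w
    _ = _ := by
        unfold expectedAtomCard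
        field_simp
        ring

theorem norm_localU3Inner_le_of_sum_norm_le (h2 : (2 : ZMod p) ≠ 0) {N : ℕ}
    (hN : ((2 * (18 * (ℓ + q) + N) : ℕ) : ℕ∞) ≤ 𝓑.rank) (hpN : ((p : ℝ) ^ N)⁻¹ ≤ 1 / 10)
    {δ : ℝ} (hδ : ((p : ℝ) ^ N)⁻¹ ≤ δ) (d : TripleLabel p ℓ q)
    {f : (Fin 3 → Fin 2) → (Fin n → ZMod p) → ℂ} (hf : ∀ ω w, ‖f ω w‖ ≤ 1)
    (hsum : ∑ w ∈ 𝓑.atom d.sigma, ‖f 0 w‖ ≤ δ * #(𝓑.atom d.sigma)) :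
    ‖𝓑.localU3Inner d f‖ ≤ 16 * δ := by
  have hp : (0 : ℝ) < p := Nat.cast_pos.2 (NeZero.pos p)
  set κ := ((p : ℝ) ^ N)⁻¹
  set X := expectedAtomCard p n ℓ q
  have hκ : 0 ≤ κ := by positivity
  have hX : 0 < X := expectedAtomCard_pos
  have hatom (a) : 9 / 10 * X ≤ #(𝓑.atom a) ∧ #(𝓑.atom a) ≤ 11 / 10 * X := by
    have hcard := abs_le.1 <| (abs_card_atom_sub_expectedAtomCard_le h2
      (natCast_le_rank hN (by omega)) a).trans (mul_le_mul_of_nonneg_right hpN hX.le)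
    constructor <;> linarith [hcard.1, hcard.2]
  have hconfigurations : ∑ v ∈ 𝓑.configurations d, ‖f 0 (v.1 0 + v.2.1 0 + v.2.2 0)‖ ≤
      9 / 4 * δ * X ^ 6 / ((p : ℝ) ^ q) ^ 12 := by
    refine (sum_configurations_le_expectedAtomCard h2 hN d (fun _ => norm_nonneg _)
      (hf 0)).trans ?_
    gcongr
    calc (1 + κ) * X ^ 5 * ∑ w ∈ 𝓑.atom d.sigma, ‖f 0 w‖ + κ * X ^ 6
        ≤ (1 + 1 / 10) * X ^ 5 * (δ * (11 / 10 * X)) + δ * X ^ 6 := by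
          gcongr
          exact hsum.trans (mul_le_mul_of_nonneg_left (hatom _).2 (hκ.trans hδ))
      _ ≤ 9 / 4 * δ * X ^ 6 := by nlinarith [mul_nonneg (hκ.trans hδ) (pow_nonneg hX.le 6)]
  calc ‖𝓑.localU3Inner d f‖
      ≤ 𝓑.configurationWeight d *
          (∑ v ∈ 𝓑.configurations d, ‖f 0 (v.1 0 + v.2.1 0 + v.2.2 0)‖) /
          (#(𝓑.atom d.a₁) ^ 2 * #(𝓑.atom d.a₂) ^ 2 * #(𝓑.atom d.a₃) ^ 2) :=
        norm_localU3Inner_le d hf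
    _ ≤ (10 / 9 * (p : ℝ) ^ q) ^ 12 * (9 / 4 * δ * X ^ 6 / ((p : ℝ) ^ q) ^ 12) /
          ((9 / 10 * X) ^ 2 * (9 / 10 * X) ^ 2 * (9 / 10 * X) ^ 2) := by
        have hweight := configurationWeight_le h2 (natCast_le_rank hN (by omega)) hpN d
        have hδ₀ := hκ.trans hδ
        gcongr <;> exact (hatom _).1
    _ = 9 / 4 * (10 / 9) ^ 18 * δ := by field_simp
    _ ≤ 16 * δ := mul_le_mul_of_nonneg_right (by norm_num) (hκ.trans hδ)

theorem localU3Norm_indicator_sub_density_le (h2 : (2 : ZMod p) ≠ 0) {N : ℕ}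
    (hN : ((2 * (18 * (ℓ + q) + N) : ℕ) : ℕ∞) ≤ 𝓑.rank) (hpN : ((p : ℝ) ^ N)⁻¹ ≤ 1 / 10)
    {ε : ℝ} (hε : ((p : ℝ) ^ N)⁻¹ ≤ ε) {d : TripleLabel p ℓ q} {A : Finset (Fin n → ZMod p)}
    (hA : density A (𝓑.atom d.sigma) ≤ ε) :
    𝓑.localU3Norm d (fun w => (if w ∈ A then 1 else 0) - (density A (𝓑.atom d.sigma) : ℂ)) ≤
      2 * ε ^ (1 / 8 : ℝ) := by
  have hε₀ : 0 ≤ ε := (density_nonneg _ _).trans hA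
  have hinner := norm_localU3Inner_le_of_sum_norm_le h2 hN hpN (δ := 2 * ε) (by linarith) d
    (fun _ => norm_indicator_sub_density_le_one A (𝓑.atom d.sigma))
    ((sum_norm_indicator_sub_density_le _ _).trans (by gcongr))
  calc 𝓑.localU3Norm d _
      ≤ (2 ^ (8 : ℝ) * ε) ^ (1 / 8 : ℝ) :=
        Real.rpow_le_rpow (norm_nonneg _) (by norm_num; linarith) (by norm_num)
    _ = 2 * ε ^ (1 / 8 : ℝ) := by
        rw [Real.mul_rpow (by positivity) hε₀, ← Real.rpow_mul zero_le_two]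
        norm_num

end QuadraticFactor

end QuadFourier

theorem mainTheorem6 (p : ℕ) [Fact p.Prime] (hp : 2 < p) (ε : ℝ) (hε : 0 < ε) :
    ∃ ρ₀ : ℝ → ℝ, QuadFourier.IsGrowthFunction ρ₀ ∧
      ∀ ρ : ℝ → ℝ, QuadFourier.IsGrowthFunction ρ → (∀ x, 0 < x → ρ₀ x ≤ ρ x) →
        ∀ (n ℓ q : ℕ) (𝓑 : QuadFourier.QuadraticFactor p n ℓ q),
          ENNReal.ofReal (ρ ((ℓ : ℝ) + (q : ℝ))) ≤ (𝓑.rank : ℝ≥0∞) →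
          ∀ (d : QuadFourier.TripleLabel p ℓ q) (A : Finset (Fin n → ZMod p)),
            QuadFourier.density A (𝓑.atom d.sigma) ≤ ε →
            𝓑.localU3Norm d
              (fun x => (if x ∈ A then 1 else 0) -
                (QuadFourier.density A (𝓑.atom d.sigma) : ℂ)) ≤ 2 * ε ^ (1 / 8 : ℝ) := by
  have hp₁ : (1 : ℝ) < p := Nat.one_lt_cast.2 (by omega)
  have h2 : (2 : ZMod p) ≠ 0 := Ring.two_ne_zero (by rw [ZMod.ringChar_zmod_n]; omega)
  obtain ⟨N, hN⟩ := exists_pow_lt_of_lt_one (lt_min hε (by norm_num : (0 : ℝ) < 1 / 10))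
    (inv_lt_one_of_one_lt₀ hp₁)
  rw [inv_pow, lt_min_iff] at hN
  refine ⟨fun x => 2 * (18 * x + N), ⟨fun x hx => by positivity, fun x _ y _ hxy => ?_⟩, ?_⟩
  · dsimp only
    gcongr
  intro ρ _ hρ n ℓ q 𝓑 hrank d A hA
  have hrankN : ((2 * (18 * (ℓ + q) + N) : ℕ) : ℕ∞) ≤ 𝓑.rank :=
    QuadFourier.QuadraticFactor.natCast_le_rank_of_ofReal_le hrank fun hq => by
      push_cast
      exact hρ _ (by positivity)
  exact QuadFourier.QuadraticFactor.localU3Norm_indicator_sub_density_le h2 hrankN hN.2.le hN.1.le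
    hA
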